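/- Let $\mathcal H$ be an infinite-dimensional separable complex Hilbert space and let $\mathcal P(\mathcal H)=\{P\in\mathcal B(\mathcal H): P=P^2=P^*\}$ be the set of orthogonal projections, with the topology of the operator norm. For $0\le i,j\le\infty$ with $i+j=\infty$ let $\mathcal P_{i,j}$ be the set of $P\in\mathcal P(\mathcal H)$ of rank $\dim R(P)=i$ and corank $\dim N(P)=j$. Let $\mathbf\Delta\subset\mathcal P(\mathcal H)\times\mathcal P(\mathcal H)$ be the set of pairs $(P,Q)$ whose ranges have a common complement, i.e. for which there is a closed subspace $\mathcal Z\subset\mathcal H$ with $R(P)\,\dot{+}\,\mathcal Z=R(Q)\,\dot{+}\,\mathcal Z=\mathcal H$ (direct sums, not necessarily orthogonal), and let $\mathbf\Delta_\infty=\mathbf\Delta\cap(\mathcal P_{\infty,\infty}\times\mathcal P_{\infty,\infty})$. Then $\mathbf\Delta_\infty$ is (non-empty and) arcwise connected: any two of its points are joined by a norm-continuous path inside $\mathbf\Delta_\infty$. Moreover $\mathbf\Delta_\infty$ is a connected component of $\mathbf\Delta$, and the connected components of $\mathbf\Delta$ are exactly the sets $\mathcal P_{i,j}\times\mathcal P_{i,j}$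 with $i+j=\infty$ and ($i<\infty$ or $j<\infty$), together with $\mathbf\Delta_\infty$. -/

import Mathlib

namespace CommonComplement

variable (H : Type*) [NormedAddCommGroup H] [InnerProductSpace ℂ H] [CompleteSpace H]

/-- The projections `P` of `B(H)`, `P = P² = P*`, with `dim R(P) = i` and `dim N(P) = j`, where all
infinite dimensions are recorded as `⊤`; as a subset of `B(H)` with the operator norm. -/
def Proj (i j : ℕ∞) : Set (H →L[ℂ] H) :=
  {P | IsStarProjection P ∧
    Cardinal.toENat (Module.rank ℂ (LinearMap.range (P : H →ₗ[ℂ] H))) = i ∧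
    Cardinal.toENat (Module.rank ℂ (LinearMap.ker (P : H →ₗ[ℂ] H))) = j}

variable {H} in
/-- `S` and `T` have a common closed complement (algebraic direct sums, not orthogonal ones). -/
def HasCommonComplement (S T : Submodule ℂ H) : Prop :=
  ∃ Z : Submodule ℂ H, IsClosed (Z : Set H) ∧ IsCompl S Z ∧ IsCompl T Z

/-- Pairs of orthogonal projections whose ranges have a common complement. -/
def Delta : Set ((H →L[ℂ] H) × (H →L[ℂ] H)) :=
  {x | IsStarProjection x.1 ∧ IsStarProjection x.2 ∧
    HasCommonComplement (LinearMap.range (x.1 : H →ₗ[ℂ] H)) (LinearMap.range (x.2 : H →ₗ[ℂ] H))}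

/-- The pairs in `Delta` of projections with infinite rank and infinite corank. -/
def DeltaInf : Set ((H →L[ℂ] H) × (H →L[ℂ] H)) :=
  Delta H ∩ Proj H ⊤ ⊤ ×ˢ Proj H ⊤ ⊤

end CommonComplement

/-! ### Moving a projection while a complement of its range stays fixed. -/

namespace CommonComplement

open Submodule

variable {H : Type*} [NormedAddCommGroup H] [InnerProductSpace ℂ H]

/-! Fix a closed `Z`. The idempotents with kernel `Z` form a convex set, and the orthogonal
projection onto the range of an idempotent `E` is `E (E + E* - 1)⁻¹`, norm-continuous in `E`. So two
projections whose ranges are complementary to `Z` are joined by a path of such projections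
(`joinedIn_of_isCompl`).

Hence `(P, Q)` in `Delta` is joined to `(Q, Q)` inside `Delta`, and only the path-connectedness of
`Proj H i j` remains. If `i` or `j` is finite, any two ranges have a common complement, by linear
algebra. If both are infinite, orthogonal infinite-dimensional ranges have one, and any two
projections are linked by a chain of orthogonal pairs (`joinedIn_proj_top`).

Conversely, projections at distance less than 1 have equal rank and corank, and so do projections
with a common complement; thus no component mixes different `(i, j)`. -/

/-- Here `p` and `q` play the orthogonal projections onto the range and the kernel of `e`; the
inverse of `e + star e - 1` is `p - q`. -/
theorem isUnit_and_eq_mul_ringInverse {A : Type*} [Ring A] [StarRing A] {p q e : A}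
    (hp : star p = p) (hq : star q = q) (hpe : p * e = e) (hep : e * p = p) (heq : e * q = 0)
    (hqe : q * (1 - e) = 1 - e) :
    IsUnit (e + star e - 1) ∧ p = e * Ring.inverse (e + star e - 1) := by
  have h1 : p * star e = p := by simpa [hp] using congrArg star hep
  have h2 : q * star e = 0 := by simpa [hq] using congrArg star heq
  have h3 : q * e = q - 1 + e := by
    have : q - q * e = 1 - e := by rw [← hqe]; noncomm_ring
    rw [eq_sub_of_add_eq' (sub_eq_iff_eq_add.mp this).symm]; abel
  have hl : (p - q) * (e + star e - 1) = 1 := by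
    have : (p - q) * (e + star e - 1) = p * e + p * star e - p - q * e - q * star e + q := by
      noncomm_ring
    rw [this, hpe, h1, h2, h3]; abel
  have hr : (e + star e - 1) * (p - q) = 1 := by
    have := congrArg star hl
    simpa [hp, hq, add_comm] using this
  let u : Aˣ := ⟨e + star e - 1, p - q, hr, hl⟩
  have hu : Ring.inverse (e + star e - 1) = p - q := Ring.inverse_unit u
  refine ⟨u.isUnit, ?_⟩
  rw [hu, mul_sub, hep, heq, sub_zero]

theorem isClosed_range_of_isIdempotentElem {E : H →L[ℂ] H} (hE : IsIdempotentElem E) :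
    IsClosed (LinearMap.range (E : H →ₗ[ℂ] H) : Set H) :=
  (ContinuousLinearMap.IsIdempotentElem.isTopCompl hE).isClosed

theorem isCompl_range_ker {E : H →L[ℂ] H} (hE : IsIdempotentElem E) :
    IsCompl (LinearMap.range (E : H →ₗ[ℂ] H)) (LinearMap.ker (E : H →ₗ[ℂ] H)) :=
  (ContinuousLinearMap.IsIdempotentElem.isTopCompl hE).isCompl

theorem apply_eq_self_of_mem_range {E : H →L[ℂ] H} (hE : IsIdempotentElem E) {x : H}
    (hx : x ∈ LinearMap.range (E : H →ₗ[ℂ] H)) : E x = x := by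
  obtain ⟨y, rfl⟩ := hx
  exact congrArg (fun T : H →L[ℂ] H => T y) hE

theorem mul_eq_right_of_range_le {E F : H →L[ℂ] H} (hE : IsIdempotentElem E)
    (h : LinearMap.range (F : H →ₗ[ℂ] H) ≤ LinearMap.range (E : H →ₗ[ℂ] H)) : E * F = F := by
  ext x
  exact apply_eq_self_of_mem_range hE (h ⟨x, rfl⟩)

theorem mul_eq_left_of_ker_le {E F : H →L[ℂ] H} (hF : IsIdempotentElem F)
    (h : LinearMap.ker (F : H →ₗ[ℂ] H) ≤ LinearMap.ker (E : H →ₗ[ℂ] H)) : E * F = E := by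
  ext x
  have hx : x - F x ∈ LinearMap.ker (F : H →ₗ[ℂ] H) := by
    have : F (F x) = F x := congrArg (fun T : H →L[ℂ] H => T x) hF
    simp [this]
  have : E (x - F x) = 0 := h hx
  rw [map_sub, sub_eq_zero] at this
  exact this.symm

theorem ker_le_of_mul_eq {E F : H →L[ℂ] H} (h : E * F = E) :
    LinearMap.ker (F : H →ₗ[ℂ] H) ≤ LinearMap.ker (E : H →ₗ[ℂ] H) := by
  intro x hx
  have hx' : F x = 0 := hx
  change E x = 0
  rw [← h]
  exact (congrArg E hx').trans (map_zero E)

variable [CompleteSpace H]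

theorem exists_isStarProjection_range_eq {S : Submodule ℂ H} (hS : IsClosed (S : Set H)) :
    ∃ P : H →L[ℂ] H, IsStarProjection P ∧ LinearMap.range (P : H →ₗ[ℂ] H) = S := by
  have := hS.completeSpace_coe
  exact ⟨S.starProjection, isStarProjection_starProjection, S.range_starProjection⟩

/-- The orthogonal projection onto the range of an idempotent is a continuous function of it. -/
theorem isUnit_and_starProjection_eq {E P : H →L[ℂ] H} (hE : IsIdempotentElem E)
    (hP : IsStarProjection P)
    (h : LinearMap.range (P : H →ₗ[ℂ] H) = LinearMap.range (E : H →ₗ[ℂ] H)) :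
    IsUnit (E + star E - 1) ∧ P = E * Ring.inverse (E + star E - 1) := by
  have hE' : IsIdempotentElem (1 - E) := hE.one_sub
  obtain ⟨Q, hQ, hQr⟩ := exists_isStarProjection_range_eq (isClosed_range_of_isIdempotentElem hE')
  refine isUnit_and_eq_mul_ringInverse hP.isSelfAdjoint.star_eq hQ.isSelfAdjoint.star_eq
    (mul_eq_right_of_range_le hP.isIdempotentElem h.ge) (mul_eq_right_of_range_le hE h.le) ?_
    (mul_eq_right_of_range_le hQ.isIdempotentElem hQr.ge)
  have := mul_eq_right_of_range_le hE' hQr.le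
  rw [sub_mul, one_mul, sub_eq_self] at this
  exact this

theorem exists_isIdempotentElem {S Z : Submodule ℂ H} (hS : IsClosed (S : Set H))
    (hZ : IsClosed (Z : Set H)) (h : IsCompl S Z) :
    ∃ E : H →L[ℂ] H, IsIdempotentElem E ∧ LinearMap.range (E : H →ₗ[ℂ] H) = S ∧
      LinearMap.ker (E : H →ₗ[ℂ] H) = Z :=
  have ht := h.isTopCompl_of_isClosed hS hZ
  ⟨S.projectionL Z ht, isIdempotentElem_projectionL ht, range_projectionL ht, ker_projectionL ht⟩

theorem joinedIn_of_isCompl {P Q : H →L[ℂ] H} (hP : IsStarProjection P) (hQ : IsStarProjection Q)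
    {Z : Submodule ℂ H} (hZ : IsClosed (Z : Set H))
    (hPZ : IsCompl (LinearMap.range (P : H →ₗ[ℂ] H)) Z)
    (hQZ : IsCompl (LinearMap.range (Q : H →ₗ[ℂ] H)) Z) :
    JoinedIn {R : H →L[ℂ] H | IsStarProjection R ∧ IsCompl (LinearMap.range (R : H →ₗ[ℂ] H)) Z}
      P Q := by
  obtain ⟨E, hE, hEr, hEk⟩ := exists_isIdempotentElem
    (isClosed_range_of_isIdempotentElem hP.isIdempotentElem) hZ hPZ
  obtain ⟨F, hF, hFr, hFk⟩ := exists_isIdempotentElem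
    (isClosed_range_of_isIdempotentElem hQ.isIdempotentElem) hZ hQZ
  -- Equal kernels give `EF = E` and `FE = F`, which keep the whole segment from `E` to `F`
  -- idempotent with kernel `Z`.
  have hEF : E * F = E := mul_eq_left_of_ker_le hF (hFk.trans hEk.symm).le
  have hFE : F * E = F := mul_eq_left_of_ker_le hE (hEk.trans hFk.symm).le
  let G : ℝ → H →L[ℂ] H := fun t => ((1 - t : ℝ) : ℂ) • E + (t : ℂ) • F
  have hGE (t : ℝ) : G t * E = G t := by
    simp only [G, add_mul, smul_mul_assoc, hE.eq, hFE]
  have hGF (t : ℝ) : G t * F = G t := by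
    simp only [G, add_mul, smul_mul_assoc, hF.eq, hEF]
  have hGG (t : ℝ) : IsIdempotentElem (G t) := by
    change G t * (((1 - t : ℝ) : ℂ) • E + (t : ℂ) • F) = G t
    rw [mul_add, mul_smul_comm, mul_smul_comm, hGE, hGF, ← add_smul]
    simp
  have hEG (t : ℝ) : E * G t = E := by
    simp only [G, mul_add, mul_smul_comm, hE.eq, hEF]
    rw [← add_smul]; simp
  have hGk (t : ℝ) : LinearMap.ker (G t : H →ₗ[ℂ] H) = Z :=
    hEk ▸ le_antisymm (ker_le_of_mul_eq (hEG t)) (ker_le_of_mul_eq (hGE t))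
  have hGc : Continuous G := by fun_prop
  choose R hR hRr using fun t =>
    exists_isStarProjection_range_eq (isClosed_range_of_isIdempotentElem (hGG t))
  have hRG (t : ℝ) := isUnit_and_starProjection_eq (hGG t) (hR t) (hRr t)
  have hRc : Continuous R := by
    have hR' : R = fun t => G t * Ring.inverse (G t + star (G t) - 1) := funext fun t => (hRG t).2
    rw [hR']
    refine hGc.mul (continuous_iff_continuousAt.2 fun t => ?_)
    have hc : Continuous fun t => G t + star (G t) - 1 := by fun_prop
    obtain ⟨u, hu⟩ := (hRG t).1
    have h1 : ContinuousAt (Ring.inverse : (H →L[ℂ] H) → _) (G t + star (G t) - 1) :=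
      hu ▸ NormedRing.inverse_continuousAt u
    exact ContinuousAt.comp (f := fun t => G t + star (G t) - 1) h1 hc.continuousAt
  refine JoinedIn.ofLine (f := R) hRc.continuousOn ?_ ?_ ?_
  · refine ContinuousLinearMap.IsStarProjection.ext (hR 0) hP ?_
    rw [hRr, ← hEr]; simp [G]
  · refine ContinuousLinearMap.IsStarProjection.ext (hR 1) hQ ?_
    rw [hRr, ← hFr]; simp [G]
  · rintro _ ⟨t, -, rfl⟩
    refine ⟨hR t, ?_⟩
    rw [hRr, ← hGk t]
    exact isCompl_range_ker (hGG t)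

end CommonComplement

namespace CommonComplement

open Submodule

/-! ### Common complements by linear algebra. -/

section Algebra

variable {K V A : Type*} [DivisionRing K] [AddCommGroup V] [Module K V] [AddCommGroup A]
  [Module K A]

/-- Modulo `S`, the maps `f + g` and `g` agree, and `T'` is a complement of `S` in `S ⊔ T`. -/
theorem disjoint_range_add {S T T' : Submodule K V} (hT : S ⊓ T ⊔ T' = T)
    (hd : Disjoint (S ⊓ T) T') {f g : A →ₗ[K] V} (hf : LinearMap.range f ≤ S)
    (hg : LinearMap.range g = T') (hg' : Function.Injective g) :
    Disjoint S (LinearMap.range (f + g)) ∧ S ⊔ LinearMap.range (f + g) = S ⊔ T := by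
  have hT' : T' ≤ T := hT ▸ le_sup_right
  have hgT (a : A) : g a ∈ T' := hg ▸ ⟨a, rfl⟩
  have hfS (a : A) : f a ∈ S := hf ⟨a, rfl⟩
  refine ⟨?_, le_antisymm (sup_le le_sup_left ?_) (sup_le le_sup_left ?_)⟩
  · rw [disjoint_def]
    rintro _ hx ⟨a, rfl⟩
    have h1 : g a ∈ S := by simpa using S.sub_mem hx (hfS a)
    have h2 : g a = 0 := disjoint_def.1 hd _ ⟨h1, hT' (hgT a)⟩ (hgT a)
    have h3 : a = 0 := hg' (h2.trans (map_zero g).symm)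
    simp [h3]
  · rintro _ ⟨a, rfl⟩
    exact add_mem_sup (hfS a) (hT' (hgT a))
  · rw [← hT]
    refine sup_le (inf_le_left.trans le_sup_left) ?_
    rw [← hg]
    rintro _ ⟨a, rfl⟩
    have : g a = -f a + (f + g) a := by simp
    rw [this]
    exact add_mem_sup (S.neg_mem (hfS a)) ⟨a, rfl⟩

/-- The map is `x ↦ x + e x`: the graph of `e` complements both `S` and `T` inside `S ⊔ T`. -/
theorem exists_isCompl_range_sup {S T S' T' W : Submodule K V} (hS : S ⊓ T ⊔ S' = S)
    (hT : S ⊓ T ⊔ T' = T) (hdS : Disjoint (S ⊓ T) S') (hdT : Disjoint (S ⊓ T) T')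
    (e : S' ≃ₗ[K] T') (hW : IsCompl (S ⊔ T) W) :
    ∃ g : S' →ₗ[K] V,
      IsCompl S (LinearMap.range g ⊔ W) ∧ IsCompl T (LinearMap.range g ⊔ W) := by
  have hS' : S' ≤ S := hS ▸ le_sup_right
  have hT' : T' ≤ T := hT ▸ le_sup_right
  let f : S' →ₗ[K] V := T'.subtype ∘ₗ e.toLinearMap
  have hf : LinearMap.range f = T' := by
    rw [LinearMap.range_comp_of_range_eq_top _ e.range, range_subtype]
  have hf' : Function.Injective f := T'.subtype_injective.comp e.injective
  obtain ⟨h1, h2⟩ := disjoint_range_add (f := S'.subtype) hT hdT (by simpa using hS') hf hf'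
  rw [inf_comm] at hS hdS
  obtain ⟨h3, h4⟩ := disjoint_range_add (f := f) hS hdS (hf.le.trans hT') S'.range_subtype
    S'.subtype_injective
  rw [add_comm] at h3 h4
  refine ⟨S'.subtype + f, h1.isCompl_sup_right_of_isCompl_sup_left (h2 ▸ hW),
    h3.isCompl_sup_right_of_isCompl_sup_left (h4 ▸ ?_)⟩
  rwa [sup_comm]

theorem exists_disjoint_sup_eq {S T : Submodule K V} (h : S ≤ T) :
    ∃ S' : Submodule K V, S ⊔ S' = T ∧ Disjoint S S' := by
  obtain ⟨C, hC⟩ := S.exists_isCompl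
  refine ⟨C ⊓ T, ?_, hC.disjoint.mono_right inf_le_left⟩
  rw [← sup_inf_assoc_of_le C h, hC.sup_eq_top, top_inf_eq]

end Algebra

/-! ### Common complements and orthogonal subspaces in a Hilbert space. -/

variable {H : Type*} [NormedAddCommGroup H] [InnerProductSpace ℂ H]

theorem hasCommonComplement_of_finrank_eq {S T : Submodule ℂ H} [FiniteDimensional ℂ S]
    [FiniteDimensional ℂ T] (h : Module.finrank ℂ S = Module.finrank ℂ T) :
    HasCommonComplement S T := by
  obtain ⟨S', hS, hdS⟩ := exists_disjoint_sup_eq (inf_le_left : S ⊓ T ≤ S)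
  obtain ⟨T', hT, hdT⟩ := exists_disjoint_sup_eq (inf_le_right : S ⊓ T ≤ T)
  have : FiniteDimensional ℂ S' := finiteDimensional_of_le (hS ▸ le_sup_right : S' ≤ S)
  have : FiniteDimensional ℂ T' := finiteDimensional_of_le (hT ▸ le_sup_right : T' ≤ T)
  have : FiniteDimensional ℂ (S ⊓ T : Submodule ℂ H) := finiteDimensional_of_le inf_le_left
  have h1 := finrank_sup_add_finrank_inf_eq (S ⊓ T) S'
  have h2 := finrank_sup_add_finrank_inf_eq (S ⊓ T) T'
  rw [hS, hdS.eq_bot, finrank_bot] at h1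
  rw [hT, hdT.eq_bot, finrank_bot] at h2
  obtain ⟨g, h3, h4⟩ := exists_isCompl_range_sup hS hT hdS hdT
    (LinearEquiv.ofFinrankEq S' T' (by omega)) (isCompl_orthogonal _)
  refine ⟨_, ?_, h3, h4⟩
  rw [sup_comm]
  exact isClosed_sup_finiteDimensional _ _ (isClosed_orthogonal _)

/-- Both `Z` and `T' ⊔ W` are complements of `S`, hence isomorphic to the quotient by `S`. Used also
with `S` and `T` exchanged, this gives `S'` and `T'` equal dimension. -/
theorem finrank_eq_of_isCompl {S T T' Z W : Submodule ℂ H} [FiniteDimensional ℂ Z]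
    (hZ : IsCompl S Z) (hT : S ⊓ T ⊔ T' = T) (hd : Disjoint (S ⊓ T) T')
    (hW : IsCompl (S ⊔ T) W) : FiniteDimensional ℂ T' ∧ FiniteDimensional ℂ W ∧
      Module.finrank ℂ Z = Module.finrank ℂ T' + Module.finrank ℂ W := by
  have hle : T' ≤ T := hT ▸ le_sup_right
  have hST : S ⊔ T' = S ⊔ T := by
    conv_rhs => rw [← hT, ← sup_assoc, sup_eq_left.2 (inf_le_left : S ⊓ T ≤ S)]
  have hdS : Disjoint S T' := by
    rw [disjoint_def] at hd ⊢
    exact fun x hx hx' => hd x ⟨hx, hle hx'⟩ hx'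
  have hc : IsCompl S (T' ⊔ W) := hdS.isCompl_sup_right_of_isCompl_sup_left (hST ▸ hW)
  let e : Z ≃ₗ[ℂ] (T' ⊔ W : Submodule ℂ H) :=
    (quotientEquivOfIsCompl S Z hZ).symm ≪≫ₗ quotientEquivOfIsCompl S _ hc
  have : FiniteDimensional ℂ (T' ⊔ W : Submodule ℂ H) := e.finiteDimensional
  have h1 : FiniteDimensional ℂ T' := finiteDimensional_of_le (le_sup_left : T' ≤ T' ⊔ W)
  have h2 : FiniteDimensional ℂ W := finiteDimensional_of_le (le_sup_right : W ≤ T' ⊔ W)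
  have hTW : Disjoint T' W := hW.disjoint.mono_left (hle.trans le_sup_right)
  have h3 := finrank_sup_add_finrank_inf_eq T' W
  rw [hTW.eq_bot, finrank_bot, add_zero] at h3
  exact ⟨h1, h2, e.finrank_eq.trans h3⟩

theorem hasCommonComplement_of_finrank_compl_eq {S T S₁ T₁ : Submodule ℂ H} (hS : IsCompl S S₁)
    (hT : IsCompl T T₁) [FiniteDimensional ℂ S₁] [FiniteDimensional ℂ T₁]
    (h : Module.finrank ℂ S₁ = Module.finrank ℂ T₁) : HasCommonComplement S T := by
  obtain ⟨S', hS', hdS⟩ := exists_disjoint_sup_eq (inf_le_left : S ⊓ T ≤ S)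
  obtain ⟨T', hT', hdT⟩ := exists_disjoint_sup_eq (inf_le_right : S ⊓ T ≤ T)
  obtain ⟨W, hW⟩ := (S ⊔ T).exists_isCompl
  obtain ⟨h1, h2, h3⟩ := finrank_eq_of_isCompl hS hT' hdT hW
  obtain ⟨h4, -, h5⟩ := finrank_eq_of_isCompl (T := S) hT (by rwa [inf_comm])
    (by rwa [inf_comm]) (by rwa [sup_comm])
  obtain ⟨g, h6, h7⟩ := exists_isCompl_range_sup hS' hT' hdS hdT
    (LinearEquiv.ofFinrankEq S' T' (by omega)) hW
  exact ⟨_, closed_of_finiteDimensional _, h6, h7⟩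

theorem exists_norm_eq_one_forall_inner_eq_zero {S : Submodule ℂ H}
    (hS : ¬ FiniteDimensional ℂ S) {s : Set H} (hs : s.Finite) :
    ∃ x ∈ S, ‖x‖ = 1 ∧ ∀ y ∈ s, inner ℂ y x = 0 := by
  have := FiniteDimensional.span_of_finite ℂ hs
  let f : S →ₗ[ℂ] span ℂ s := (span ℂ s).orthogonalProjectionOnto.toLinearMap ∘ₗ S.subtype
  have hf : ¬ Function.Injective f := fun hf => hS (Module.Finite.of_injective f hf)
  rw [← LinearMap.ker_eq_bot, Submodule.eq_bot_iff] at hf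
  push Not at hf
  obtain ⟨x, hx, hx0⟩ := hf
  have hx1 : (x : H) ≠ 0 := by simpa using hx0
  have hx2 : (x : H) ∈ (span ℂ s)ᗮ :=
    orthogonalProjectionOnto_eq_zero_iff.1 hx
  refine ⟨((‖(x : H)‖⁻¹ : ℝ) : ℂ) • (x : H), S.smul_mem _ x.2, ?_, fun y hy => ?_⟩
  · rw [norm_smul]
    simp [hx1]
  · rw [inner_smul_right, hx2 y (subset_span hy), mul_zero]

theorem nonempty_hilbertBasis_nat {E : Type*} [NormedAddCommGroup E] [InnerProductSpace ℂ E]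
    [CompleteSpace E] [TopologicalSpace.SeparableSpace E] (hE : ¬ FiniteDimensional ℂ E) :
    Nonempty (HilbertBasis ℕ ℂ E) := by
  obtain ⟨w, b, -⟩ := exists_hilbertBasis ℂ E
  have hc : Countable w := by
    refine Pairwise.countable_of_isOpen_disjoint (s := fun i => Metric.ball (b i) (1 / 2)) ?_
      (fun i => Metric.isOpen_ball) (fun i => ⟨b i, Metric.mem_ball_self (by norm_num)⟩)
    intro i j hij
    refine Metric.ball_disjoint_ball ?_
    -- Distinct basis vectors are `√2` apart, so the balls of radius `1/2` are disjoint and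
    -- separability makes the basis countable.
    have h1 : ‖b i - b j‖ * ‖b i - b j‖ = 2 := by
      rw [@norm_sub_mul_self ℂ, b.orthonormal.1 i, b.orthonormal.1 j, b.orthonormal.2 hij]
      norm_num
    rw [dist_eq_norm]
    nlinarith [norm_nonneg (b i - b j)]
  have hi : Infinite w := by
    by_contra hfin
    rw [not_infinite_iff_finite] at hfin
    have := Fintype.ofFinite w
    exact hE b.toOrthonormalBasis.toBasis.finiteDimensional_of_finite
  obtain ⟨_⟩ := nonempty_denumerable_iff.2 ⟨hc, hi⟩
  have f : ℕ ≃ w := (Denumerable.eqv w).symm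
  refine ⟨HilbertBasis.mk (b.orthonormal.comp f f.injective) ?_⟩
  rw [Set.range_comp, f.range_eq_univ, Set.image_univ, b.dense_span]

/-- Choose alternately unit vectors in `S` and in `T`, each orthogonal to all earlier ones; `S₁` and
`T₁` are the two closed spans. -/
theorem exists_isOrtho_of_not_finiteDimensional {S T : Submodule ℂ H}
    (hS : IsClosed (S : Set H)) (hT : IsClosed (T : Set H)) (hS' : ¬ FiniteDimensional ℂ S)
    (hT' : ¬ FiniteDimensional ℂ T) :
    ∃ S₁ ≤ S, ∃ T₁ ≤ T, IsClosed (S₁ : Set H) ∧ IsClosed (T₁ : Set H) ∧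
      ¬ FiniteDimensional ℂ S₁ ∧ ¬ FiniteDimensional ℂ T₁ ∧ S₁ ⟂ T₁ := by
  obtain ⟨f, hf, hfr⟩ := exists_seq_of_forall_finset_exists
    (fun x : H × H => x.1 ∈ S ∧ x.2 ∈ T ∧ ‖x.1‖ = 1 ∧ ‖x.2‖ = 1 ∧ inner ℂ x.1 x.2 = 0)
    (fun x y => inner ℂ x.1 y.1 = 0 ∧ inner ℂ x.1 y.2 = 0 ∧ inner ℂ x.2 y.1 = 0 ∧
      inner ℂ x.2 y.2 = 0) (by
      intro s _
      have hs : (Set.image Prod.fst (s : Set (H × H)) ∪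
          Set.image Prod.snd (s : Set (H × H))).Finite :=
        (s.finite_toSet.image _).union (s.finite_toSet.image _)
      obtain ⟨x, hxS, hx1, hx⟩ := exists_norm_eq_one_forall_inner_eq_zero hS' hs
      obtain ⟨y, hyT, hy1, hy⟩ := exists_norm_eq_one_forall_inner_eq_zero hT' (hs.insert x)
      refine ⟨(x, y), ⟨hxS, hyT, hx1, hy1, hy x (Set.mem_insert _ _)⟩, fun z hz => ?_⟩
      have h1 := Set.mem_union_left (Set.image Prod.snd (s : Set (H × H)))
        (Set.mem_image_of_mem Prod.fst hz)
      have h2 := Set.mem_union_right (Set.image Prod.fst (s : Set (H × H)))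
        (Set.mem_image_of_mem Prod.snd hz)
      exact ⟨hx _ h1, hy _ (Or.inr h1), hx _ h2, hy _ (Or.inr h2)⟩)
  have key (g : ℕ → H) (hg1 : ∀ n, ‖g n‖ = 1) (hg2 : ∀ m n, m < n → inner ℂ (g m) (g n) = 0) :
      ¬ FiniteDimensional ℂ (span ℂ (Set.range g)).topologicalClosure := by
    intro hfin
    have ho : Orthonormal ℂ g := by
      refine ⟨hg1, fun m n hmn => ?_⟩
      rcases hmn.lt_or_gt with h | h
      · exact hg2 m n h
      · exact inner_eq_zero_symm.1 (hg2 n m h)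
    have hle := (span ℂ (Set.range g)).le_topologicalClosure
    have hli : LinearIndependent ℂ fun n =>
        (⟨g n, hle (subset_span ⟨n, rfl⟩)⟩ : (span ℂ (Set.range g)).topologicalClosure) :=
      LinearIndependent.of_comp (span ℂ (Set.range g)).topologicalClosure.subtype
        ho.linearIndependent
    exact Infinite.not_finite hli.finite
  refine ⟨_, topologicalClosure_minimal _ (span_le.2 ?_) hS, _,
    topologicalClosure_minimal _ (span_le.2 ?_) hT, isClosed_topologicalClosure _,
    isClosed_topologicalClosure _, key (fun n => (f n).1) (fun n => (hf n).2.2.1)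
      (fun m n h => (hfr m n h).1), key (fun n => (f n).2) (fun n => (hf n).2.2.2.1)
      (fun m n h => (hfr m n h).2.2.2), ?_⟩
  · rintro _ ⟨n, rfl⟩; exact (hf n).1
  · rintro _ ⟨n, rfl⟩; exact (hf n).2.1
  · have h0 : span ℂ (Set.range fun n => (f n).1) ⟂ span ℂ (Set.range fun n => (f n).2) := by
      rw [isOrtho_span]
      rintro _ ⟨m, rfl⟩ _ ⟨n, rfl⟩
      rcases lt_trichotomy m n with h | rfl | h
      · exact (hfr m n h).2.1
      · exact (hf m).2.2.2.2
      · exact inner_eq_zero_symm.1 (hfr n m h).2.2.1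
    have h1 := topologicalClosure_minimal _ h0 (isClosed_orthogonal _)
    exact IsOrtho.symm (topologicalClosure_minimal _ (IsOrtho.symm h1) (isClosed_orthogonal _))

variable [CompleteSpace H]

/-- The complement is the graph of `e` plus `(S ⊔ T)ᗮ`. It is the kernel of `J`, a retraction onto
`S`, and so also of `-eJ`, a retraction onto `T`. -/
theorem hasCommonComplement_of_isOrtho {S T : Submodule ℂ H} (hS : IsClosed (S : Set H))
    (hT : IsClosed (T : Set H)) (h : S ⟂ T) (e : S ≃L[ℂ] T) : HasCommonComplement S T := by
  have := hS.completeSpace_coe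
  have := hT.completeSpace_coe
  let J : H →L[ℂ] S :=
    S.orthogonalProjectionOnto - (e.symm : T →L[ℂ] S) ∘L T.orthogonalProjectionOnto
  have hJS (x : S) : J x = x := by
    have : T.orthogonalProjectionOnto (x : H) = 0 :=
      orthogonalProjectionOnto_eq_zero_iff.2 (h x.2)
    simp [J, this]
  have hJT (x : T) : -(e (J x)) = x := by
    have : S.orthogonalProjectionOnto (x : H) = 0 :=
      orthogonalProjectionOnto_eq_zero_iff.2 (h.symm x.2)
    simp [J, this]
  refine ⟨LinearMap.ker (J : H →ₗ[ℂ] S), J.isClosed_ker,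
    (ContinuousLinearMap.isTopCompl_of_proj hJS).isCompl, ?_⟩
  have h2 := (ContinuousLinearMap.isTopCompl_of_proj (f := -((e : S →L[ℂ] T) ∘L J)) hJT).isCompl
  convert h2 using 1
  ext x
  simp

theorem nonempty_continuousLinearEquiv [TopologicalSpace.SeparableSpace H] {S T : Submodule ℂ H}
    (hS : IsClosed (S : Set H)) (hT : IsClosed (T : Set H)) (hS' : ¬ FiniteDimensional ℂ S)
    (hT' : ¬ FiniteDimensional ℂ T) : Nonempty (S ≃L[ℂ] T) := by
  have := hS.completeSpace_coe
  have := hT.completeSpace_coe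
  have := UniformSpace.secondCountable_of_separable H
  obtain ⟨b⟩ := nonempty_hilbertBasis_nat hS'
  obtain ⟨c⟩ := nonempty_hilbertBasis_nat hT'
  exact ⟨(b.repr.trans c.repr.symm).toContinuousLinearEquiv⟩

end CommonComplement

/-! ### Rank and corank as invariants; nonemptiness of the strata. -/

namespace CommonComplement

open Submodule Cardinal Topology

variable {H : Type*} [NormedAddCommGroup H] [InnerProductSpace ℂ H]

theorem ker_eq_range_one_sub {P : H →L[ℂ] H} (hP : IsIdempotentElem P) :
    LinearMap.ker (P : H →ₗ[ℂ] H) = LinearMap.range ((1 - P : H →L[ℂ] H) : H →ₗ[ℂ] H) :=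
  LinearMap.IsIdempotentElem.ker_eq_range_one_sub (congrArg ContinuousLinearMap.toLinearMap hP)

/-- `Q` is injective on the range of `P`: if `Px = x` and `Qx = 0`, then `‖x‖ = ‖(P - Q)x‖`, which
forces `x = 0`. -/
theorem rank_range_le_of_norm_sub_lt_one {P Q : H →L[ℂ] H} (hP : IsIdempotentElem P)
    (h : ‖P - Q‖ < 1) : Module.rank ℂ (LinearMap.range (P : H →ₗ[ℂ] H)) ≤
      Module.rank ℂ (LinearMap.range (Q : H →ₗ[ℂ] H)) := by
  refine LinearMap.rank_le_of_injective
    ((Q : H →ₗ[ℂ] H).rangeRestrict ∘ₗ (LinearMap.range (P : H →ₗ[ℂ] H)).subtype) ?_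
  rw [injective_iff_map_eq_zero]
  intro x hx
  have hQx : Q x = 0 := congrArg Subtype.val hx
  have hPx : P x = x := apply_eq_self_of_mem_range hP x.2
  have h1 : ‖(x : H)‖ ≤ ‖P - Q‖ * ‖(x : H)‖ := by
    simpa [hQx, hPx] using (P - Q).le_opNorm x
  by_contra hne
  have h2 : 0 < ‖(x : H)‖ := norm_pos_iff.2 (by simpa using hne)
  nlinarith

theorem rank_range_eq_of_norm_sub_lt_one {P Q : H →L[ℂ] H} (hP : IsIdempotentElem P)
    (hQ : IsIdempotentElem Q) (h : ‖P - Q‖ < 1) :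
    Module.rank ℂ (LinearMap.range (P : H →ₗ[ℂ] H)) =
      Module.rank ℂ (LinearMap.range (Q : H →ₗ[ℂ] H)) :=
  (rank_range_le_of_norm_sub_lt_one hP h).antisymm
    (rank_range_le_of_norm_sub_lt_one hQ (by rwa [norm_sub_rev]))

theorem rank_ker_eq_of_norm_sub_lt_one {P Q : H →L[ℂ] H} (hP : IsIdempotentElem P)
    (hQ : IsIdempotentElem Q) (h : ‖P - Q‖ < 1) :
    Module.rank ℂ (LinearMap.ker (P : H →ₗ[ℂ] H)) =
      Module.rank ℂ (LinearMap.ker (Q : H →ₗ[ℂ] H)) := by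
  rw [ker_eq_range_one_sub hP, ker_eq_range_one_sub hQ]
  refine rank_range_eq_of_norm_sub_lt_one hP.one_sub hQ.one_sub ?_
  rwa [sub_sub_sub_cancel_left, norm_sub_rev]

theorem toENat_rank_eq_top {V : Type*} [AddCommGroup V] [Module ℂ V] :
    toENat (Module.rank ℂ V) = ⊤ ↔ ¬ FiniteDimensional ℂ V := by
  rw [toENat_eq_top, ← not_lt, Module.rank_lt_aleph0_iff]

theorem toENat_rank_range_add_ker (hH : ¬ FiniteDimensional ℂ H) (P : H →L[ℂ] H) :
    toENat (Module.rank ℂ (LinearMap.range (P : H →ₗ[ℂ] H))) +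
      toENat (Module.rank ℂ (LinearMap.ker (P : H →ₗ[ℂ] H))) = ⊤ := by
  rw [← map_add, LinearMap.rank_range_add_rank_ker, toENat_rank_eq_top]
  exact hH

variable [CompleteSpace H]

theorem orthogonal_range_eq_ker {P : H →L[ℂ] H} (hP : IsStarProjection P) :
    (LinearMap.range (P : H →ₗ[ℂ] H))ᗮ = LinearMap.ker (P : H →ₗ[ℂ] H) :=
  (ContinuousLinearMap.IsStarProjection.isSymmetricProjection hP).isSymmetric.orthogonal_range

/-- Both ranges are isomorphic to `H / Z`, and both kernels to `Z`. -/
theorem mem_proj_of_isCompl {i j : ℕ∞} {P Q : H →L[ℂ] H} (hP : P ∈ Proj H i j)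
    (hQ : IsStarProjection Q) {Z : Submodule ℂ H}
    (hPZ : IsCompl (LinearMap.range (P : H →ₗ[ℂ] H)) Z)
    (hQZ : IsCompl (LinearMap.range (Q : H →ₗ[ℂ] H)) Z) : Q ∈ Proj H i j := by
  refine ⟨hQ, ?_, ?_⟩
  · rw [← hP.2.1, ((quotientEquivOfIsCompl _ _ hQZ.symm).symm ≪≫ₗ
      quotientEquivOfIsCompl _ _ hPZ.symm).rank_eq]
  · have hP' := isCompl_range_ker hP.1.isIdempotentElem
    have hQ' := isCompl_range_ker hQ.isIdempotentElem
    rw [← hP.2.2, ((quotientEquivOfIsCompl _ _ hQ').symm ≪≫ₗ quotientEquivOfIsCompl _ _ hQZ ≪≫ₗ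
      (quotientEquivOfIsCompl _ _ hPZ).symm ≪≫ₗ quotientEquivOfIsCompl _ _ hP').rank_eq]

theorem snd_mem_proj_of_mem_delta {i j : ℕ∞} {x : (H →L[ℂ] H) × (H →L[ℂ] H)} (hx : x ∈ Delta H)
    (h : x.1 ∈ Proj H i j) : x.2 ∈ Proj H i j := by
  obtain ⟨-, h2, Z, -, hPZ, hQZ⟩ := hx
  exact mem_proj_of_isCompl h h2 hPZ hQZ

theorem one_sub_mem_proj {i j : ℕ∞} {P : H →L[ℂ] H} (hP : P ∈ Proj H i j) :
    1 - P ∈ Proj H j i := by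
  have hi := hP.1.isIdempotentElem
  refine ⟨hP.1.one_sub, ?_, ?_⟩
  · rw [← ker_eq_range_one_sub hi, hP.2.2]
  · rw [ker_eq_range_one_sub hi.one_sub, sub_sub_cancel, hP.2.1]

theorem proj_natCast_top_nonempty (hH : ¬ FiniteDimensional ℂ H) (n : ℕ) :
    (Proj H n ⊤).Nonempty := by
  have hn : (n : Cardinal) ≤ Module.rank ℂ H :=
    natCast_le_aleph0.trans (toENat_eq_top.1 (toENat_rank_eq_top.2 hH))
  obtain ⟨v, hv⟩ := Module.le_rank_iff.1 hn
  have := FiniteDimensional.span_of_finite ℂ (Set.finite_range v)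
  obtain ⟨P, hP, hPr⟩ := exists_isStarProjection_range_eq
    (span ℂ (Set.range v)).closed_of_finiteDimensional
  have hr : toENat (Module.rank ℂ (LinearMap.range (P : H →ₗ[ℂ] H))) = n := by
    rw [hPr, rank_span hv, ← toENat_congr (Equiv.ofInjective v hv.injective)]
    simp
  refine ⟨P, hP, hr, ?_⟩
  have := toENat_rank_range_add_ker hH P
  rw [hr] at this
  simpa using this

theorem proj_top_top_nonempty (hH : ¬ FiniteDimensional ℂ H) : (Proj H ⊤ ⊤).Nonempty := by
  have hT : ¬ FiniteDimensional ℂ (⊤ : Submodule ℂ H) := fun h =>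
    hH (topEquiv : (⊤ : Submodule ℂ H) ≃ₗ[ℂ] H).finiteDimensional
  obtain ⟨S, -, T, -, hS, -, hS', hT', hST⟩ := exists_isOrtho_of_not_finiteDimensional
    (S := ⊤) (T := ⊤) isClosed_univ isClosed_univ hT hT
  obtain ⟨P, hP, rfl⟩ := exists_isStarProjection_range_eq hS
  refine ⟨P, hP, toENat_rank_eq_top.2 hS', toENat_rank_eq_top.2 fun h => hT' ?_⟩
  rw [← orthogonal_range_eq_ker hP] at h
  exact finiteDimensional_of_le hST.symm

theorem proj_nonempty (hH : ¬ FiniteDimensional ℂ H) {i j : ℕ∞} (hij : i + j = ⊤) :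
    (Proj H i j).Nonempty := by
  induction i with
  | top =>
    induction j with
    | top => exact proj_top_top_nonempty hH
    | coe n =>
      obtain ⟨P, hP⟩ := proj_natCast_top_nonempty hH n
      exact ⟨1 - P, one_sub_mem_proj hP⟩
  | coe n =>
    have : j = ⊤ := by simpa using hij
    exact this ▸ proj_natCast_top_nonempty hH n

theorem hasCommonComplement_of_mem_proj {i j : ℕ∞} (h : i < ⊤ ∨ j < ⊤) {P Q : H →L[ℂ] H}
    (hP : P ∈ Proj H i j) (hQ : Q ∈ Proj H i j) :
    HasCommonComplement (LinearMap.range (P : H →ₗ[ℂ] H)) (LinearMap.range (Q : H →ₗ[ℂ] H)) := by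
  rcases h with h | h
  · have h1 := hP.2.1 ▸ h
    have h2 := hQ.2.1 ▸ h
    rw [toENat_lt_top, Module.rank_lt_aleph0_iff] at h1 h2
    refine hasCommonComplement_of_finrank_eq ?_
    exact congrArg ENat.toNat (hP.2.1.trans hQ.2.1.symm)
  · have h1 := hP.2.2 ▸ h
    have h2 := hQ.2.2 ▸ h
    rw [toENat_lt_top, Module.rank_lt_aleph0_iff] at h1 h2
    refine hasCommonComplement_of_finrank_compl_eq (isCompl_range_ker hP.1.isIdempotentElem)
      (isCompl_range_ker hQ.1.isIdempotentElem) ?_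
    exact congrArg ENat.toNat (hP.2.2.trans hQ.2.2.symm)

theorem joinedIn_proj_of_hasCommonComplement {i j : ℕ∞} {P Q : H →L[ℂ] H} (hP : P ∈ Proj H i j)
    (hQ : IsStarProjection Q) (h : HasCommonComplement (LinearMap.range (P : H →ₗ[ℂ] H))
      (LinearMap.range (Q : H →ₗ[ℂ] H))) : JoinedIn (Proj H i j) P Q := by
  obtain ⟨Z, hZ, hPZ, hQZ⟩ := h
  exact (joinedIn_of_isCompl hP.1 hQ hZ hPZ hQZ).mono fun R hR =>
    mem_proj_of_isCompl hP hR.1 hPZ hR.2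

/-- Only the first projection moves; `Z` remains a common complement throughout. -/
theorem joinedIn_delta_diagonal {i j : ℕ∞} {x : (H →L[ℂ] H) × (H →L[ℂ] H)}
    (hx : x ∈ Delta H ∩ Proj H i j ×ˢ Proj H i j) :
    JoinedIn (Delta H ∩ Proj H i j ×ˢ Proj H i j) x (x.2, x.2) := by
  obtain ⟨⟨h1, h2, Z, hZ, hPZ, hQZ⟩, h3, h4⟩ := hx
  refine ((joinedIn_of_isCompl h1 h2 hZ hPZ hQZ).prod
    (JoinedIn.refl (Set.mem_singleton x.2))).mono ?_
  rintro ⟨R, _⟩ ⟨⟨hR, hRZ⟩, rfl⟩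
  exact ⟨⟨hR, h2, Z, hZ, hRZ, hQZ⟩, mem_proj_of_isCompl h3 hR hPZ hRZ, h4⟩

theorem mk_self_mem_delta {i j : ℕ∞} {P : H →L[ℂ] H} (hP : P ∈ Proj H i j) :
    (P, P) ∈ Delta H ∩ Proj H i j ×ˢ Proj H i j :=
  have hc := isCompl_range_ker hP.1.isIdempotentElem
  ⟨⟨hP.1, hP.1, _, P.isClosed_ker, hc, hc⟩, hP, hP⟩

theorem delta_inter_eq {i j : ℕ∞} (h : i < ⊤ ∨ j < ⊤) :
    Delta H ∩ Proj H i j ×ˢ Proj H i j = Proj H i j ×ˢ Proj H i j :=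
  Set.inter_eq_right.2 fun _ hx =>
    ⟨hx.1.1, hx.2.1, hasCommonComplement_of_mem_proj h hx.1 hx.2⟩

/-! ### Path-connectedness of the strata and the components of `Delta`. -/

variable [TopologicalSpace.SeparableSpace H]

theorem joinedIn_proj_top_of_isOrtho {P Q : H →L[ℂ] H} (hP : P ∈ Proj H ⊤ ⊤)
    (hQ : IsStarProjection Q) (hQ' : ¬ FiniteDimensional ℂ (LinearMap.range (Q : H →ₗ[ℂ] H)))
    (h : LinearMap.range (P : H →ₗ[ℂ] H) ⟂ LinearMap.range (Q : H →ₗ[ℂ] H)) :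
    JoinedIn (Proj H ⊤ ⊤) P Q := by
  have hPc := isClosed_range_of_isIdempotentElem hP.1.isIdempotentElem
  have hQc := isClosed_range_of_isIdempotentElem hQ.isIdempotentElem
  obtain ⟨e⟩ := nonempty_continuousLinearEquiv hPc hQc (toENat_rank_eq_top.1 hP.2.1) hQ'
  exact joinedIn_proj_of_hasCommonComplement hP hQ (hasCommonComplement_of_isOrtho hPc hQc h e)

/-- Chain `P, E, F, Q` with consecutive ranges orthogonal: `E` lives in the kernel of `P`, `F` in
that of `Q`, and the two are chosen orthogonal. -/
theorem joinedIn_proj_top {P Q : H →L[ℂ] H} (hP : P ∈ Proj H ⊤ ⊤) (hQ : Q ∈ Proj H ⊤ ⊤) :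
    JoinedIn (Proj H ⊤ ⊤) P Q := by
  obtain ⟨S, hSP, T, hTQ, hS, hT, hS', hT', hST⟩ := exists_isOrtho_of_not_finiteDimensional
    P.isClosed_ker Q.isClosed_ker (toENat_rank_eq_top.1 hP.2.2) (toENat_rank_eq_top.1 hQ.2.2)
  obtain ⟨E, hE, rfl⟩ := exists_isStarProjection_range_eq hS
  obtain ⟨F, hF, rfl⟩ := exists_isStarProjection_range_eq hT
  rw [← orthogonal_range_eq_ker hP.1] at hSP
  rw [← orthogonal_range_eq_ker hQ.1] at hTQ
  have h1 := joinedIn_proj_top_of_isOrtho hP hE hS' (IsOrtho.symm hSP)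
  have h2 := joinedIn_proj_top_of_isOrtho hQ hF hT' (IsOrtho.symm hTQ)
  exact (h1.trans (joinedIn_proj_top_of_isOrtho h1.target_mem hF hT' hST)).trans h2.symm

theorem joinedIn_proj {i j : ℕ∞} {P Q : H →L[ℂ] H} (hP : P ∈ Proj H i j) (hQ : Q ∈ Proj H i j) :
    JoinedIn (Proj H i j) P Q := by
  by_cases h : i < ⊤ ∨ j < ⊤
  · exact joinedIn_proj_of_hasCommonComplement hP hQ.1 (hasCommonComplement_of_mem_proj h hP hQ)
  · simp only [not_or, not_lt_top_iff] at h
    obtain ⟨rfl, rfl⟩ := h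
    exact joinedIn_proj_top hP hQ

theorem isPathConnected_delta_inter (hH : ¬ FiniteDimensional ℂ H) {i j : ℕ∞}
    (hij : i + j = ⊤) : IsPathConnected (Delta H ∩ Proj H i j ×ˢ Proj H i j) := by
  rw [isPathConnected_iff]
  obtain ⟨P, hP⟩ := proj_nonempty hH hij
  refine ⟨⟨_, mk_self_mem_delta hP⟩, fun x hx y hy => ?_⟩
  have h : JoinedIn (Delta H ∩ Proj H i j ×ˢ Proj H i j) (x.2, x.2) (y.2, y.2) := by
    refine ((joinedIn_proj hx.2.2 hy.2.2).map (f := fun R => (R, R)) (by fun_prop)).mono ?_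
    rintro _ ⟨R, hR, rfl⟩
    exact mk_self_mem_delta hR
  exact ((joinedIn_delta_diagonal hx).trans h).trans (joinedIn_delta_diagonal hy).symm

theorem connectedComponentIn_delta (hH : ¬ FiniteDimensional ℂ H) {i j : ℕ∞} (hij : i + j = ⊤)
    {x : (H →L[ℂ] H) × (H →L[ℂ] H)} (hx : x ∈ Delta H ∩ Proj H i j ×ˢ Proj H i j) :
    connectedComponentIn (Delta H) x = Delta H ∩ Proj H i j ×ˢ Proj H i j := by
  refine Set.Subset.antisymm (fun y hy => ?_)
    ((isPathConnected_delta_inter hH hij).isConnected.isPreconnected.subset_connectedComponentIn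
      hx Set.inter_subset_left)
  have hsub := connectedComponentIn_subset (Delta H) x
  -- Membership of the first coordinate is locally constant, hence constant on the component; the
  -- second coordinate follows through the common complement.
  have key : x.1 ∈ Proj H i j ↔ y.1 ∈ Proj H i j := by
    refine isPreconnected_connectedComponentIn.induction₂
      (fun x y : (H →L[ℂ] H) × (H →L[ℂ] H) => x.1 ∈ Proj H i j ↔ y.1 ∈ Proj H i j) ?_
      (fun _ _ _ _ _ _ h h' => h.trans h') (fun _ _ _ _ h => h.symm)
      (mem_connectedComponentIn hx.1) hy
    intro z hz
    have hc : Filter.Tendsto (fun w : (H →L[ℂ] H) × (H →L[ℂ] H) => ‖z.1 - w.1‖)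
        (𝓝[connectedComponentIn (Delta H) x] z) (𝓝 0) := by
      have : Continuous fun w : (H →L[ℂ] H) × (H →L[ℂ] H) => ‖z.1 - w.1‖ := by fun_prop
      simpa using (this.tendsto z).mono_left nhdsWithin_le_nhds
    filter_upwards [hc.eventually_lt_const zero_lt_one, self_mem_nhdsWithin] with w hw hwC
    have hz1 := (hsub hz).1
    have hw1 := (hsub hwC).1
    simp only [Proj, Set.mem_ofPred_eq, hz1, hw1, true_and,
      rank_range_eq_of_norm_sub_lt_one hz1.isIdempotentElem hw1.isIdempotentElem hw,
      rank_ker_eq_of_norm_sub_lt_one hz1.isIdempotentElem hw1.isIdempotentElem hw]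
  have hy1 := key.1 hx.2.1
  exact ⟨hsub hy, hy1, snd_mem_proj_of_mem_delta (hsub hy) hy1⟩

end CommonComplement

open CommonComplement

theorem mainTheorem2 (H : Type*) [NormedAddCommGroup H] [InnerProductSpace ℂ H] [CompleteSpace H]
    [TopologicalSpace.SeparableSpace H] (hH : ¬ FiniteDimensional ℂ H) :
    IsPathConnected (CommonComplement.DeltaInf H) ∧
    (∀ x ∈ CommonComplement.DeltaInf H,
      connectedComponentIn (CommonComplement.Delta H) x = CommonComplement.DeltaInf H) ∧
    {C | ∃ x ∈ CommonComplement.Delta H,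
        C = connectedComponentIn (CommonComplement.Delta H) x} =
      {C | ∃ i j : ℕ∞, i + j = ⊤ ∧ (i < ⊤ ∨ j < ⊤) ∧
        C = CommonComplement.Proj H i j ×ˢ CommonComplement.Proj H i j} ∪
      {CommonComplement.DeltaInf H} := by
  refine ⟨isPathConnected_delta_inter hH rfl,
    fun x hx => connectedComponentIn_delta hH rfl hx, Set.ext fun C => ⟨?_, ?_⟩⟩
  · rintro ⟨x, hx, rfl⟩
    obtain ⟨i, j, hij, hx1⟩ : ∃ i j : ℕ∞, i + j = ⊤ ∧ x.1 ∈ Proj H i j :=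
      ⟨_, _, toENat_rank_range_add_ker hH x.1, hx.1, rfl, rfl⟩
    rw [connectedComponentIn_delta hH hij ⟨hx, hx1, snd_mem_proj_of_mem_delta hx hx1⟩]
    by_cases h : i < ⊤ ∨ j < ⊤
    · exact Or.inl ⟨i, j, hij, h, delta_inter_eq h⟩
    · simp only [not_or, not_lt_top_iff] at h
      obtain ⟨rfl, rfl⟩ := h
      exact Or.inr rfl
  · rintro (⟨i, j, hij, h, rfl⟩ | rfl)
    · obtain ⟨P, hP⟩ := proj_nonempty hH hij
      have hx := mk_self_mem_delta hP
      exact ⟨_, hx.1, by rw [connectedComponentIn_delta hH hij hx, delta_inter_eq h]⟩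
    · obtain ⟨P, hP⟩ := proj_top_top_nonempty hH
      have hx := mk_self_mem_delta hP
      exact ⟨_, hx.1, (connectedComponentIn_delta hH rfl hx).symm⟩
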